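/- All graphs are finite, simple and undirected; a graph is nontrivial if it has at least two vertices. For a graph $G$ let $\delta(G)$ be its minimum degree and let the connectivity $\kappa(G)$ be the minimum number of vertices whose removal from $G$ results in a disconnected graph or a graph with exactly one vertex. A graph $G$ is maximally connected if $\kappa(G)=\delta(G)$. Let $G$ and $H$ be graphs with $V(H)=\{w_1,\dots,w_q\}$. The exponential graph $G^H$ has vertex set $$V(G^H)=\{(u_1,\dots,u_q;w_j) : u_i\in V(G)\ (1\le i\le q),\ 1\le j\le q\},$$ and $(u_1,\dots,u_q;w_j)$ and $(v_1,\dots,v_q;w_k)$ are adjacent if and only if either $j=k$, $u_jv_j\in E(G)$ and $u_i=v_i$ for all $i\ne j$; or $j\neq k$, $w_jw_k\in E(H)$ and $u_i=v_i$ for all $i$. **Theorem.** For any nontrivial connected graphs $G$ and $H$, the exponential graph $G^H$ is maximally connected; that is, $$\kappa(G^H)=\delta(G^H)=\delta(G)+\delta(H).$$ -/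

import Mathlib

/-- `n` vertices can be removed from `G`, not all of them, so that the remaining graph is
disconnected or trivial (a single vertex). -/
def SimpleGraph.IsCutSize {V : Type*} [Fintype V] (G : SimpleGraph V) (n : ℕ) : Prop :=
  ∃ S : Finset V, S ≠ Finset.univ ∧ S.card = n ∧
    (¬ (G.induce {v : V | v ∉ S}).Connected ∨ Fintype.card V = S.card + 1)

/-- A finite graph with at least one vertex has a removable set as in `IsCutSize`, so that the
minimum below is over a nonempty set. -/
theorem SimpleGraph.exists_isCutSize {V : Type*} [Fintype V] [Nonempty V]
    (G : SimpleGraph V) : ∃ n, G.IsCutSize n := by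
  classical
  obtain ⟨v⟩ := ‹Nonempty V›
  refine ⟨(Finset.univ.erase v).card, Finset.univ.erase v, ?_, rfl, Or.inr ?_⟩
  · intro h
    have hv := Finset.mem_univ v
    rw [← h] at hv
    exact Finset.notMem_erase v Finset.univ hv
  · exact (Finset.card_erase_add_one (Finset.mem_univ v)).symm

/-- The (vertex-)connectivity `κ(G)`: the minimum number of vertices whose removal from `G` results
in a disconnected graph or a trivial graph. -/
noncomputable def SimpleGraph.vertexConnectivity {V : Type*} [Fintype V]
    (G : SimpleGraph V) : ℕ :=
  sInf {n : ℕ | G.IsCutSize n}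

/-- `G` is maximally connected: `κ(G) = δ(G)`. -/
def SimpleGraph.IsMaximallyConnected {V : Type*} [Fintype V]
    (G : SimpleGraph V) [DecidableRel G.Adj] : Prop :=
  G.vertexConnectivity = G.minDegree

/-- The exponential graph `G^H` with base `G` and exponent `H`. Its vertices are the pairs `(u, w)`
of a tuple `u` of vertices of `G` indexed by the vertices of `H`, and a vertex `w` of `H`. -/
def SimpleGraph.expGraph {V W : Type*} (G : SimpleGraph V) (H : SimpleGraph W) :
    SimpleGraph ((W → V) × W) where
  Adj x y :=
    (x.2 = y.2 ∧ G.Adj (x.1 x.2) (y.1 x.2) ∧ ∀ i, i ≠ x.2 → x.1 i = y.1 i) ∨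
    (x.2 ≠ y.2 ∧ H.Adj x.2 y.2 ∧ ∀ i, x.1 i = y.1 i)
  symm := ⟨by
    rintro ⟨u, j⟩ ⟨v, k⟩ (⟨h, ha, he⟩ | ⟨h, ha, he⟩)
    · dsimp only at h ha he
      subst h
      exact Or.inl ⟨rfl, ha.symm, fun i hi => (he i hi).symm⟩
    · exact Or.inr ⟨h.symm, ha.symm, fun i => (he i).symm⟩⟩
  loopless := ⟨by
    rintro ⟨u, j⟩ (⟨_, ha, _⟩ | ⟨h, _, _⟩)
    · exact G.irrefl ha
    · exact h rfl⟩

/-! The upper bound deletes the neighbourhood of a vertex of minimum degree, δ(G) + δ(H) by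
`minDegree_expGraph`. For the lower bound let |S| < δ(G) + δ(H), and call a copy of H clean if it
avoids S. Unclean copies are indexed by the projection T of S to tuples. As δ(H) < q, |T| ≤ δ(G) + q
- 2, and `iff_of_subcube` shows that the box power of G on q ≥ 2 factors stays connected without T.
So all clean copies lie in one component. By `exists_copy_avoiding` every surviving vertex reaches a
clean copy: otherwise S would contain δ(G) + δ(H) distinct vertices. Connectedness is tested
throughout by predicates constant along surviving edges. -/

/-! ### Box powers of a connected graph -/

open Function in
/-- A predicate that is constant along the edges of a connected graph in one coordinate is constant
on the whole line in that coordinate. -/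
theorem SimpleGraph.Connected.iff_update_of_line {V W : Type*} [DecidableEq W]
    {G : SimpleGraph V} (hG : G.Connected) {T : Finset (W → V)} {c : (W → V) → Prop}
    (hc : ∀ a ∉ T, ∀ i v, G.Adj (a i) v → update a i v ∉ T → (c a ↔ c (update a i v)))
    {u : W → V} {j : W} (hu : ∀ v, update u j v ∉ T) (v v' : V) :
    c (update u j v) ↔ c (update u j v') := by
  obtain ⟨p⟩ := hG.preconnected v v'
  induction p with
  | nil => rfl
  | @cons a b d h _ ih =>
    have := hc (update u j a) (hu a) j b (by simpa using h) (by simpa using hu b)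
    rw [update_idem] at this
    exact this.trans ih

open Function in
/-- The previous fact for a subcube with free coordinates `s` that avoids `T`. -/
theorem SimpleGraph.Connected.iff_of_avoiding_subcube {V W : Type*} [DecidableEq W]
    {G : SimpleGraph V} (hG : G.Connected) {T : Finset (W → V)} {c : (W → V) → Prop}
    (hc : ∀ a ∉ T, ∀ i v, G.Adj (a i) v → update a i v ∉ T → (c a ↔ c (update a i v)))
    (s : Finset W) : ∀ u u' : W → V, (∀ i ∉ s, u i = u' i) →
      (∀ x, (∀ i ∉ s, x i = u i) → x ∉ T) → (c u ↔ c u') := by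
  induction s using Finset.induction_on with
  | empty =>
    intro u u' h _
    rw [funext fun i => h i (Finset.notMem_empty i)]
  | insert j s hj ih =>
    intro u u' h hT
    have h1 : ∀ v, update u j v ∉ T := fun v => hT _ fun i hi => by
      rw [update_of_ne (fun e => hi (by simp [e]))]
    have h2 := hG.iff_update_of_line hc h1 (u j) (u' j)
    rw [update_eq_self] at h2
    refine h2.trans (ih _ _ (fun i hi => ?_) fun x hx => hT x fun i hi => ?_)
    · by_cases e : i = j
      · subst e; simp
      · rw [update_of_ne e]; exact h i (by simp [e, hi])
    · have e : i ≠ j := fun e => hi (by simp [e])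
      rw [hx i (fun h => hi (by simp [h])), update_of_ne e]

/-- Shows that there are more parallel lines in a subcube than removed points, with d = δ(G) and m =
|V|. -/
theorem Nat.add_lt_pow_add_one {d m : ℕ} (hm : 2 ≤ m) (hd : d < m) (k : ℕ) :
    d + k < m ^ (k + 1) := by
  induction k with
  | zero => simpa using hd
  | succ k ih =>
    have : m ^ (k + 1) * 2 ≤ m ^ (k + 1) * m := Nat.mul_le_mul_left _ hm
    rw [pow_succ]
    omega

/-- If fewer points than lines are removed from a subcube, some line survives. -/
theorem exists_line_avoiding {V W : Type*} [Fintype V] [Fintype W] [DecidableEq V] [DecidableEq W]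
    (T : Finset (W → V)) (s : Finset W) (j : W) (hj : j ∉ s) (u : W → V)
    (hT : (T.filter fun x => ∀ i ∉ insert j s, x i = u i).card < Fintype.card V ^ s.card) :
    ∃ x : W → V, (∀ i ∉ insert j s, x i = u i) ∧ ∀ v, Function.update x j v ∉ T := by
  set F := T.filter fun x => ∀ i ∉ insert j s, x i = u i with hF
  obtain ⟨g, hg⟩ : ∃ g : s → V, g ∉ F.image fun (x : W → V) (i : s) => x i := by
    by_contra! h
    have h1 := Finset.card_image_le (s := F) (f := fun (x : W → V) (i : s) => x i)
    rw [Finset.eq_univ_iff_forall.2 h, Finset.card_univ, Fintype.card_fun,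
      Fintype.card_coe] at h1
    omega
  have hx : ∀ i ∉ insert j s, (fun i => if h : i ∈ s then g ⟨i, h⟩ else u i) i = u i :=
    fun i hi => dif_neg fun h => hi (Finset.mem_insert_of_mem h)
  refine ⟨fun i => if h : i ∈ s then g ⟨i, h⟩ else u i, hx, fun v hv => hg ?_⟩
  refine Finset.mem_image.2 ⟨_, Finset.mem_filter.2 ⟨hv, fun i hi => ?_⟩, funext fun i => ?_⟩
  · rw [Function.update_of_ne fun e => hi (by simp [e])]
    exact hx i hi
  · rw [Function.update_of_ne fun e => hj (by rw [← e]; exact i.2)]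
    simp

open Function in
/-- A box power of a connected graph with at least two factors stays connected when at most
`δ + s.card - 2` vertices are removed, where `s` is the set of factors and `δ` the minimum degree of
the base. Connectedness is expressed by predicates that are constant along edges. -/
theorem SimpleGraph.Connected.iff_of_subcube {V W : Type*} [Fintype V] [Fintype W]
    [DecidableEq V] [DecidableEq W] [Nontrivial V]
    {G : SimpleGraph V} [DecidableRel G.Adj] (hG : G.Connected)
    {T : Finset (W → V)} {c : (W → V) → Prop}
    (hc : ∀ a ∉ T, ∀ i v, G.Adj (a i) v → update a i v ∉ T → (c a ↔ c (update a i v)))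
    (s : Finset W) : 2 ≤ s.card → ∀ u u' : W → V, u ∉ T → u' ∉ T → (∀ i ∉ s, u' i = u i) →
      (T.filter fun x => ∀ i ∉ s, x i = u i).card + 2 ≤ G.minDegree + s.card →
      (c u ↔ c u') := by
  induction s using Finset.induction_on with
  | empty => simp
  | insert j s hj ih =>
    intro hs u u' hu hu' h hT
    rw [Finset.card_insert_of_notMem hj] at hs hT
    have hm : 2 ≤ Fintype.card V := Fintype.one_lt_card
    have hd : G.minDegree < Fintype.card V := G.minDegree_lt_card
    obtain ⟨x, hx, hxT⟩ := exists_line_avoiding T s j hj u (by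
      have := Nat.add_lt_pow_add_one hm hd (s.card - 1)
      rw [Nat.sub_add_cancel (by omega)] at this
      omega)
    set F := T.filter fun x => ∀ i ∉ insert j s, x i = u i with hF
    have hline : ∀ v, c (update x j v) ↔ c x := fun v => by
      simpa using hG.iff_update_of_line hc hxT v (x j)
    have hagree : ∀ y : W → V, (∀ i ∉ insert j s, y i = u i) →
        ∀ z : W → V, (∀ i ∉ s, z i = y i) → ∀ i ∉ insert j s, z i = u i := fun y hy z hz i hi =>
      (hz i fun h => hi (Finset.mem_insert_of_mem h)).trans (hy i hi)
    have hxy : ∀ y : W → V, (∀ i ∉ insert j s, y i = u i) →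
        ∀ i ∉ s, update x j (y j) i = y i := fun y hy i hi => by
      by_cases e : i = j
      · subst e; simp
      · have : i ∉ insert j s := by simp [e, hi]
        rw [update_of_ne e, hx i this, hy i this]
    -- A layer fixes coordinate j. One without removed points is connected, and it meets the
    -- surviving line through `x`.
    have hlayer : ∀ y : W → V, (∀ i ∉ insert j s, y i = u i) → (∀ t ∈ F, t j ≠ y j) →
        (c y ↔ c x) := fun y hy hcl => by
      refine (hG.iff_of_avoiding_subcube hc s y (update x j (y j))
        (fun i hi => (hxy y hy i hi).symm) fun z hz hzT => ?_).trans (hline _)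
      exact hcl z (Finset.mem_filter.2 ⟨hzT, hagree y hy z hz⟩) (hz j hj)
    have main : ∀ y : W → V, y ∉ T → (∀ i ∉ insert j s, y i = u i) → (c y ↔ c x) := by
      intro y hyT hy
      by_cases h0 : ∀ t ∈ F, t j ≠ y j
      · exact hlayer y hy h0
      by_cases h1 : ∃ v, G.Adj (y j) v ∧ ∀ t ∈ F, t j ≠ v
      · obtain ⟨v, hv, hvF⟩ := h1
        have hy' : ∀ i ∉ insert j s, update y j v i = u i := fun i hi => by
          rw [update_of_ne fun e => hi (by simp [e]), hy i hi]
        refine (hc y hyT j v hv fun hT' => ?_).trans (hlayer _ hy' (by simpa using hvF))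
        exact hvF _ (Finset.mem_filter.2 ⟨hT', hy'⟩) (by simp)
      push Not at h0 h1
      obtain ⟨t₀, ht₀, ht₀j⟩ := h0
      -- Each of the at least δ neighbouring layers holds a removed point, so at most `s.card - 1`
      -- remain for the layer of `y`.
      have hcard : G.minDegree + (F.filter fun t => t j = y j).card ≤ F.card := by
        rw [← Finset.card_filter_add_card_filter_not (s := F) (fun t => t j = y j), add_comm]
        refine Nat.add_le_add_left ((G.minDegree_le_degree (y j)).trans ?_) _
        rw [← G.card_neighborFinset_eq_degree]
        refine (Finset.card_le_card (t := (F.filter fun t => ¬ t j = y j).image fun t => t j)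
          fun v hv => ?_).trans Finset.card_image_le
        rw [mem_neighborFinset] at hv
        obtain ⟨t, ht, rfl⟩ := h1 v hv
        exact Finset.mem_image.2 ⟨t, Finset.mem_filter.2 ⟨ht, hv.ne'⟩, rfl⟩
      have hpos : 0 < (F.filter fun t => t j = y j).card :=
        Finset.card_pos.2 ⟨t₀, Finset.mem_filter.2 ⟨ht₀, ht₀j⟩⟩
      have hdpos : 0 < G.minDegree := hG.preconnected.minDegree_pos_of_nontrivial
      -- The layer of `y` does contain a removed point, which forces `2 ≤ s.card`; the bound needed
      -- inside it follows from δ ≥ 1.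
      refine (ih (by omega) y (update x j (y j)) hyT (hxT _) (hxy y hy) ?_).trans (hline _)
      have hsub : (T.filter fun z => ∀ i ∉ s, z i = y i).card ≤
          (F.filter fun t => t j = y j).card := Finset.card_le_card fun z hz => by
        obtain ⟨hzT, hz⟩ := Finset.mem_filter.1 hz
        exact Finset.mem_filter.2 ⟨Finset.mem_filter.2 ⟨hzT, hagree y hy z hz⟩, hz j hj⟩
      omega
    exact (main u hu fun _ _ => rfl).trans (main u' hu' h).symm

/-! ### Cuts and connectedness in general graphs -/

namespace SimpleGraph

/-- The neighbourhood of a vertex is a cut, or leaves a single vertex. -/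
theorem isCutSize_degree {V : Type*} [Fintype V] (G : SimpleGraph V) [DecidableRel G.Adj] (x : V) :
    G.IsCutSize (G.degree x) := by
  classical
  have hx : x ∉ G.neighborFinset x := by simp
  refine ⟨G.neighborFinset x, fun h => hx (h ▸ Finset.mem_univ x), rfl, ?_⟩
  by_cases h : ∃ y, y ≠ x ∧ y ∉ G.neighborFinset x
  · obtain ⟨y, hyx, hy⟩ := h
    refine Or.inl fun hc => ?_
    have : Nontrivial {v : V | v ∉ G.neighborFinset x} :=
      ⟨⟨⟨x, hx⟩, ⟨y, hy⟩, fun e => hyx (congrArg Subtype.val e).symm⟩⟩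
    obtain ⟨z, hz⟩ := hc.preconnected.exists_adj_of_nontrivial ⟨x, hx⟩
    exact z.2 (by simpa using hz)
  · push Not at h
    refine Or.inr ?_
    rw [← Finset.card_insert_of_notMem hx, ← Finset.card_univ]
    congr 1
    refine (Finset.eq_univ_iff_forall.2 fun y => ?_).symm
    by_cases e : y = x
    · simp [e]
    · exact Finset.mem_insert_of_mem (h y e)

/-- A graph is connected off `S` if each predicate that is constant along the edges off `S` is
constant off `S`. -/
theorem connected_induce_of_forall_iff {V : Type*} (G : SimpleGraph V) {S : Finset V} {x₀ : V}
    (hx₀ : x₀ ∉ S) (h : ∀ f : V → Prop, (∀ x ∉ S, ∀ y ∉ S, G.Adj x y → (f x ↔ f y)) →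
      ∀ x ∉ S, ∀ y ∉ S, (f x ↔ f y)) :
    (G.induce {v : V | v ∉ S}).Connected := by
  have : Nonempty {v : V | v ∉ S} := ⟨⟨x₀, hx₀⟩⟩
  refine ⟨fun a b => ?_⟩
  have key := h (fun y => ∃ hy : y ∉ S, (G.induce {v : V | v ∉ S}).Reachable a ⟨y, hy⟩) ?_
    a a.2 b b.2
  · exact (key.1 ⟨a.2, Reachable.refl _⟩).2
  · intro x hx y hy hxy
    have hadj : (G.induce {v : V | v ∉ S}).Adj ⟨x, hx⟩ ⟨y, hy⟩ := by simpa using hxy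
    exact ⟨fun ⟨_, hr⟩ => ⟨hy, hr.trans hadj.reachable⟩,
      fun ⟨_, hr⟩ => ⟨hx, hr.trans hadj.symm.reachable⟩⟩

/-! ### Degrees and connectivity of the exponential graph -/

section ExpGraph

variable {V W : Type*} {G : SimpleGraph V} {H : SimpleGraph W}

theorem expGraph_adj_update [DecidableEq W] {u : W → V} {j : W} {v : V} (h : G.Adj (u j) v) :
    (G.expGraph H).Adj (u, j) (Function.update u j v, j) :=
  Or.inl ⟨rfl, by simpa using h, fun i hi => (Function.update_of_ne hi _ _).symm⟩

theorem expGraph_adj_right {u : W → V} {j k : W} (h : H.Adj j k) :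
    (G.expGraph H).Adj (u, j) (u, k) :=
  Or.inr ⟨h.ne, h, fun _ => rfl⟩

theorem degree_expGraph [Fintype V] [Fintype W] [DecidableEq W] [DecidableRel G.Adj]
    [DecidableRel H.Adj] [DecidableRel (G.expGraph H).Adj] (u : W → V) (j : W) :
    (G.expGraph H).degree (u, j) = G.degree (u j) + H.degree j := by
  classical
  have hset : (G.expGraph H).neighborFinset (u, j) =
      ((G.neighborFinset (u j)).image fun v => (Function.update u j v, j)) ∪
        (H.neighborFinset j).image fun k => (u, k) := by
    ext ⟨v, k⟩
    simp only [mem_neighborFinset, Finset.mem_union, Finset.mem_image, Prod.mk.injEq]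
    constructor
    · rintro (⟨h, ha, he⟩ | ⟨-, ha, he⟩)
      · dsimp only at h ha he
        subst h
        refine Or.inl ⟨v j, ha, funext fun i => ?_, rfl⟩
        by_cases e : i = j
        · subst e; simp
        · rw [Function.update_of_ne e, he i e]
      · exact Or.inr ⟨k, ha, funext he, rfl⟩
    · rintro (⟨w, hw, rfl, rfl⟩ | ⟨l, hl, rfl, rfl⟩)
      · exact expGraph_adj_update hw
      · exact expGraph_adj_right hl
  rw [← card_neighborFinset_eq_degree, hset, Finset.card_union_of_disjoint,
    Finset.card_image_of_injective, Finset.card_image_of_injective,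
    card_neighborFinset_eq_degree, card_neighborFinset_eq_degree]
  · intro a b h
    simpa using h
  · intro a b h
    exact Function.update_injective u j (by simpa using h)
  · rw [Finset.disjoint_left]
    rintro _ h1 h2
    obtain ⟨v, hv, rfl⟩ := Finset.mem_image.1 h1
    obtain ⟨k, hk, e⟩ := Finset.mem_image.1 h2
    rw [mem_neighborFinset] at hk
    exact hk.ne (congrArg Prod.snd e).symm

theorem minDegree_expGraph [Fintype V] [Fintype W] [DecidableEq W] [Nonempty V] [Nonempty W]
    [DecidableRel G.Adj] [DecidableRel H.Adj] [DecidableRel (G.expGraph H).Adj] :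
    (G.expGraph H).minDegree = G.minDegree + H.minDegree := by
  apply le_antisymm
  · obtain ⟨v, hv⟩ := G.exists_minimal_degree_vertex
    obtain ⟨j, hj⟩ := H.exists_minimal_degree_vertex
    rw [hv, hj, ← degree_expGraph (H := H) (fun _ => v) j]
    exact minDegree_le_degree _ _
  · refine le_minDegree_of_forall_le_degree _ _ ?_
    rintro ⟨u, j⟩
    rw [degree_expGraph]
    exact Nat.add_le_add (minDegree_le_degree _ _) (minDegree_le_degree _ _)

open Function in
/-- From any vertex off a small set `S` one can reach a copy of `H` that avoids `S`. -/
theorem exists_copy_avoiding [Fintype V] [Fintype W] [DecidableEq W] [Nontrivial V]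
    [DecidableRel G.Adj] [DecidableRel H.Adj] (hG : G.Connected)
    {S : Finset ((W → V) × W)} (hS : S.card < G.minDegree + H.minDegree)
    {f : (W → V) × W → Prop}
    (hf : ∀ x ∉ S, ∀ y ∉ S, (G.expGraph H).Adj x y → (f x ↔ f y))
    (u : W → V) (j : W) (hu : (u, j) ∉ S) :
    ∃ u' : W → V, (∀ k, (u', k) ∉ S) ∧ ∃ k, f (u, j) ↔ f (u', k) := by
  classical
  by_contra hno
  have hit : ∀ u' k, (f (u, j) ↔ f (u', k)) → ∃ l, (u', l) ∈ S := fun u' k h => by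
    by_contra! hcl
    exact hno ⟨u', hcl, k, h⟩
  have hp : ∀ v ∈ G.neighborFinset (u j), ∃ l, (update u j v, l) ∈ S := fun v hv => by
    by_cases h : (update u j v, j) ∈ S
    · exact ⟨j, h⟩
    · exact hit _ j (hf _ hu _ h (expGraph_adj_update (by simpa using hv)))
  -- If `(u, k)` survives, one further step in coordinate `k` leads into another copy, which S must
  -- also hit.
  have hq : ∀ k ∈ H.neighborFinset j, ∃ x ∈ S,
      x = (u, k) ∨ ∃ v, G.Adj (u k) v ∧ x.1 = update u k v := fun k hk => by
    obtain ⟨v, hv⟩ := hG.preconnected.exists_adj_of_nontrivial (u k)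
    by_cases h : (u, k) ∈ S
    · exact ⟨_, h, Or.inl rfl⟩
    by_cases h' : (update u k v, k) ∈ S
    · exact ⟨_, h', Or.inr ⟨v, hv, rfl⟩⟩
    obtain ⟨l, hl⟩ := hit (update u k v) k
      ((hf _ hu _ h (expGraph_adj_right (by simpa using hk))).trans
        (hf _ h _ h' (expGraph_adj_update hv)))
    exact ⟨_, hl, Or.inr ⟨v, hv, rfl⟩⟩
  have : Nonempty W := ⟨j⟩
  choose! p hp using hp
  choose! q hqS hq using hq
  have hqj : ∀ k ∈ H.neighborFinset j, (q k).1 j = u j := fun k hk => by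
    have hjk : j ≠ k := ((mem_neighborFinset _ _ _).1 hk).ne
    rcases hq k hk with h | ⟨v, -, h⟩
    · rw [h]
    · rw [h, update_of_ne hjk]
  -- The tuple of `q k` differs from `u` at most in coordinate `k`; if it equals `u`, the second
  -- component is `k`.
  have hqk : ∀ k ∈ H.neighborFinset j, ∀ l ∈ H.neighborFinset j, q k = q l → k = l := by
    intro k hk l hl e
    by_contra hkl
    rcases hq k hk with h | ⟨v, hv, h⟩ <;> rcases hq l hl with h' | ⟨w, hw, h'⟩
    · exact hkl (congrArg Prod.snd (h.symm.trans (e.trans h')))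
    · have := congrFun h' l
      rw [← e, h, update_self] at this
      exact hw.ne this
    · have := congrFun h k
      rw [e, h', update_self] at this
      exact hv.ne this
    · have := congrFun h k
      rw [e, h', update_self, update_of_ne hkl] at this
      exact hv.ne this
  have hcard : ((G.neighborFinset (u j)).image (fun v => (update u j v, p v)) ∪
      (H.neighborFinset j).image q).card ≤ S.card := Finset.card_le_card fun x hx => by
    rcases Finset.mem_union.1 hx with hx | hx <;> obtain ⟨a, ha, rfl⟩ := Finset.mem_image.1 hx
    · exact hp a ha
    · exact hqS a ha
  rw [Finset.card_union_of_disjoint, Finset.card_image_of_injective, Finset.card_image_of_injOn,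
    card_neighborFinset_eq_degree, card_neighborFinset_eq_degree] at hcard
  · have h1 := G.minDegree_le_degree (u j)
    have h2 := H.minDegree_le_degree j
    omega
  · exact fun k hk l hl e => hqk k hk l hl e
  · exact fun a b h => update_injective u j (congrArg Prod.fst h)
  -- The first family changes coordinate `j` of `u`, the second keeps it.
  · rw [Finset.disjoint_left]
    rintro _ h1 h2
    obtain ⟨v, hv, rfl⟩ := Finset.mem_image.1 h1
    obtain ⟨k, hk, e⟩ := Finset.mem_image.1 h2
    have : v = u j := by simpa [e] using hqj k hk
    exact ((mem_neighborFinset _ _ _).1 hv).ne this.symm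

open Function in
theorem connected_induce_expGraph [Fintype V] [Fintype W] [DecidableEq W] [Nontrivial V]
    [Nontrivial W] [DecidableRel G.Adj] [DecidableRel H.Adj] (hG : G.Connected) (hH : H.Connected)
    {S : Finset ((W → V) × W)} (hS : S.card < G.minDegree + H.minDegree)
    {x₀ : (W → V) × W} (hx₀ : x₀ ∉ S) :
    ((G.expGraph H).induce {x | x ∉ S}).Connected := by
  classical
  refine connected_induce_of_forall_iff _ hx₀ fun f hf => ?_
  have hcopy : ∀ u : W → V, (∀ k, (u, k) ∉ S) → ∀ k l, f (u, k) ↔ f (u, l) := fun u hu k l => by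
    obtain ⟨p⟩ := hH.preconnected k l
    induction p with
    | nil => rfl
    | cons h _ ih => exact (hf _ (hu _) _ (hu _) (expGraph_adj_right h)).trans ih
  have hT : ∀ u : W → V, u ∉ S.image Prod.fst ↔ ∀ k, (u, k) ∉ S := fun u => by simp
  have hclean : ∀ u u' : W → V, (∀ k, (u, k) ∉ S) → (∀ k, (u', k) ∉ S) → ∀ k l,
      (f (u, k) ↔ f (u', l)) := by
    intro u u' hu hu' k l
    refine Iff.trans ?_ (hcopy u' hu' k l)
    refine hG.iff_of_subcube (T := S.image Prod.fst) (c := fun u => f (u, k)) ?_ Finset.univ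
      ?_ u u' ((hT u).2 hu) ((hT u').2 hu') (by simp) ?_
    · intro a ha i v hv hb
      rw [hT] at ha hb
      exact (hcopy a ha k i).trans
        ((hf _ (ha i) _ (hb i) (expGraph_adj_update hv)).trans (hcopy _ hb i k))
    · exact Fintype.one_lt_card
    · have h1 : ((S.image Prod.fst).filter fun x => ∀ i ∉ Finset.univ, x i = u i).card ≤ S.card :=
        (Finset.card_filter_le _ _).trans Finset.card_image_le
      -- This strict inequality supplies the second unit in the bound |T| + 2 ≤ δ(G) + q.
      have h2 := H.minDegree_lt_card
      rw [Finset.card_univ]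
      omega
  rintro ⟨u, j⟩ hu ⟨u', j'⟩ hu'
  obtain ⟨a, ha, k, hk⟩ := exists_copy_avoiding hG hS hf u j hu
  obtain ⟨b, hb, l, hl⟩ := exists_copy_avoiding hG hS hf u' j' hu'
  exact hk.trans ((hclean a b ha hb k l).trans hl.symm)

theorem vertexConnectivity_expGraph [Fintype V] [Fintype W] [DecidableEq W] [Nontrivial V]
    [Nontrivial W] [DecidableRel G.Adj] [DecidableRel H.Adj] (hG : G.Connected)
    (hH : H.Connected) :
    (G.expGraph H).vertexConnectivity = G.minDegree + H.minDegree := by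
  classical
  rw [← minDegree_expGraph]
  obtain ⟨x, hx⟩ := (G.expGraph H).exists_minimal_degree_vertex
  refine le_antisymm (hx ▸ Nat.sInf_le ((G.expGraph H).isCutSize_degree x))
    (le_csInf ⟨_, (G.expGraph H).isCutSize_degree x⟩ ?_)
  rintro n ⟨S, hSu, rfl, hS | hS⟩
  · by_contra! hlt
    obtain ⟨x₀, hx₀⟩ : ∃ x₀, x₀ ∉ S := by
      by_contra! h
      exact hSu (Finset.eq_univ_iff_forall.2 h)
    rw [minDegree_expGraph] at hlt
    exact hS (connected_induce_expGraph hG hH hlt hx₀)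
  · have := (G.expGraph H).minDegree_lt_card
    omega

end ExpGraph

end SimpleGraph
theorem mainTheorem1 {V W : Type*} [Fintype V] [Fintype W] [DecidableEq W]
    [Nontrivial V] [Nontrivial W]
    (G : SimpleGraph V) (H : SimpleGraph W)
    [DecidableRel G.Adj] [DecidableRel H.Adj] [DecidableRel (G.expGraph H).Adj]
    (hG : G.Connected) (hH : H.Connected) :
    (G.expGraph H).IsMaximallyConnected ∧
      (G.expGraph H).vertexConnectivity = G.minDegree + H.minDegree := by
  refine ⟨?_, SimpleGraph.vertexConnectivity_expGraph hG hH⟩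
  rw [SimpleGraph.IsMaximallyConnected, SimpleGraph.minDegree_expGraph,
    SimpleGraph.vertexConnectivity_expGraph hG hH]
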